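/- A family of points in $\mathbb{R}^3$ is convexly independent if no point of the family lies in the convex hull of the other points of the family (so the points are pairwise distinct and are the vertices of their convex hull). For a finite set $P\subset\mathbb{R}^3$ let $E(P)$ be the maximum number of unordered pairs of distinct points of $P$ such that the midpoints of these pairs are convexly independent, and let $E_3(n)=\max\{E(P) : P\subset\mathbb{R}^3,\ |P|=n\}$. Then $$\left\lfloor \tfrac13 n^2\right\rfloor\le E_3(n)\le \tfrac38 n^2+O(n^{3/2}),$$ that is, the lower bound holds for every integer $n\ge 0$, and there is an absolute constant $C$ such that $E_3(n)\le \frac38 n^2+C n^{3/2}$ for every integer $n\ge 0$. -/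

import Mathlib

namespace MidpointGraphs

/-- The midpoint of an unordered pair of points of `ℝ^d`. -/
noncomputable def pairMidpoint {d : ℕ} (e : Sym2 (EuclideanSpace ℝ (Fin d))) :
    EuclideanSpace ℝ (Fin d) :=
  Sym2.lift ⟨fun p q => midpoint ℝ p q, fun p q => midpoint_comm (R := ℝ) p q⟩ e

/-- The midpoints of the pairs in `S` are convexly independent: the midpoint of a pair in `S` never
lies in the convex hull of the midpoints of other pairs in `S`. In particular different pairs have
different midpoints. -/
def MidpointsConvexIndependent {d : ℕ} (S : Finset (Sym2 (EuclideanSpace ℝ (Fin d)))) : Prop :=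
  ConvexIndependent ℝ (fun e : S => pairMidpoint (e : Sym2 (EuclideanSpace ℝ (Fin d))))

open Classical in
/-- The set of all unordered pairs of two different points of `P`. -/
noncomputable def pairs {d : ℕ} (P : Finset (EuclideanSpace ℝ (Fin d))) :
    Finset (Sym2 (EuclideanSpace ℝ (Fin d))) :=
  P.sym2.filter (fun e => ¬ e.IsDiag)

open Classical in
/-- `E(P)`: the maximum number of pairs of points of `P` whose midpoints are convexly
independent. -/
noncomputable def maxPairs {d : ℕ} (P : Finset (EuclideanSpace ℝ (Fin d))) : ℕ :=
  ((pairs P).powerset.filter MidpointsConvexIndependent).sup Finset.card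

/-- `E_d(n)`: the maximum of `E(P)` over all sets `P` of `n` points in `ℝ^d`. -/
noncomputable def E (d n : ℕ) : ℕ :=
  sSup {m : ℕ | ∃ P : Finset (EuclideanSpace ℝ (Fin d)), P.card = n ∧ maxPairs P = m}

theorem maxPairs_le {d : ℕ} (P : Finset (EuclideanSpace ℝ (Fin d))) :
    maxPairs P ≤ (P.card + 1).choose 2 := by
  classical
  refine Finset.sup_le fun S hS => ?_
  have h1 : S ⊆ pairs P := Finset.mem_powerset.mp (Finset.mem_filter.mp hS).1
  rw [← Finset.card_sym2]
  exact Finset.card_le_card (h1.trans (Finset.filter_subset _ _))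

/-- The supremum defining `E_d(n)` is a true maximum when `d ≥ 1`. -/
theorem isGreatest_E (d n : ℕ) (hd : 0 < d) :
    IsGreatest {m : ℕ | ∃ P : Finset (EuclideanSpace ℝ (Fin d)), P.card = n ∧ maxPairs P = m}
      (E d n) := by
  have hb : BddAbove
      {m : ℕ | ∃ P : Finset (EuclideanSpace ℝ (Fin d)), P.card = n ∧ maxPairs P = m} := by
    refine ⟨(n + 1).choose 2, ?_⟩
    rintro m ⟨P, rfl, rfl⟩
    exact maxPairs_le P
  have : Nonempty (Fin d) := ⟨⟨0, hd⟩⟩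
  have : Infinite (EuclideanSpace ℝ (Fin d)) := Module.Free.infinite ℝ _
  obtain ⟨P, hP⟩ := Infinite.exists_subset_card_eq (EuclideanSpace ℝ (Fin d)) n
  exact ⟨Nat.sSup_mem ⟨_, P, hP, rfl⟩ hb, fun m hm => le_csSup hb hm⟩

end MidpointGraphs

namespace MidpointGraphs

/-! The chosen pairs form a graph, and convex independence of the midpoints says exactly that each
edge is exposed by a linear functional. Upper bound: Radon applied to a 5-clique in space puts one
vertex v in the hull of the other four (`EdgesExposed.exists_center`), and v is then the only common
neighbour of those four (`EdgesExposed.exists_unique_common_neighbor`). So deleting the four costs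
at most three edges per remaining vertex, plus one for v and six inside; once no 5-clique is left,
Turán's theorem gives density 3/8. The error term obtained is linear, n/4. Lower bound: the Turán
graph with three parts is drawn on three parabola arcs, on which every edge between different arcs
is exposed (`exists_exposing_functional`). -/

/-- Every edge of `G`, drawn with vertices `p`, has a linear functional whose sum over the two
endpoints is strictly larger than over the endpoints of any other edge. -/
def EdgesExposed {W V : Type*} [AddCommGroup V] [Module ℝ V] (G : SimpleGraph W) (p : W → V) :
    Prop :=
  ∀ x y, G.Adj x y → ∃ f : V →ₗ[ℝ] ℝ, ∀ z w, G.Adj z w → s(z, w) ≠ s(x, y) →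
    f (p z) + f (p w) < f (p x) + f (p y)

/-! ### Convex hulls and Radon partitions of indexed points. -/

section Convexity

variable {V : Type*} [AddCommGroup V] [Module ℝ V]

theorem lt_of_mem_convexHull (f : V →ₗ[ℝ] ℝ) {A : Set V} {c : ℝ} (hA : ∀ z ∈ A, f z < c) {x : V}
    (hx : x ∈ convexHull ℝ A) : f x < c :=
  convexHull_min (t := {z | f z < c}) hA (convex_halfSpace_lt f.isLinear c) hx

theorem le_of_mem_convexHull (f : V →ₗ[ℝ] ℝ) {A : Set V} {c : ℝ} (hA : ∀ z ∈ A, c ≤ f z) {x : V}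
    (hx : x ∈ convexHull ℝ A) : c ≤ f x :=
  convexHull_min (t := {z | c ≤ f z}) hA (convex_halfSpace_ge f.isLinear c) hx

theorem mem_convexHull_image_finset {W : Type*} (p : W → V) (Q : Finset W) {x : V}
    (hx : x ∈ convexHull ℝ (p '' Q)) :
    ∃ a : W → ℝ, (∀ i ∈ Q, 0 ≤ a i) ∧ ∑ i ∈ Q, a i = 1 ∧ ∑ i ∈ Q, a i • p i = x := by
  classical
  have hconv : Convex ℝ {x : V | ∃ a : W → ℝ, (∀ i ∈ Q, 0 ≤ a i) ∧ ∑ i ∈ Q, a i = 1 ∧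
      ∑ i ∈ Q, a i • p i = x} := by
    rintro x ⟨a, ha, ha1, rfl⟩ y ⟨b, hb, hb1, rfl⟩ s t hs ht hst
    refine ⟨fun i => s * a i + t * b i, fun i hi => ?_, ?_, ?_⟩
    · exact add_nonneg (mul_nonneg hs (ha i hi)) (mul_nonneg ht (hb i hi))
    · rw [Finset.sum_add_distrib, ← Finset.mul_sum, ← Finset.mul_sum, ha1, hb1]
      linarith
    · simp only [add_smul, mul_smul, Finset.sum_add_distrib, Finset.smul_sum]
  refine convexHull_min ?_ hconv hx
  rintro _ ⟨i, hi, rfl⟩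
  have hi' : i ∈ Q := hi
  refine ⟨fun j => if j = i then 1 else 0, fun j _ => ?_, ?_, ?_⟩
  · dsimp only
    split_ifs <;> norm_num
  · simp [hi']
  · simp [ite_smul, hi']

theorem radon_partition_finset {W : Type*} [FiniteDimensional ℝ V] (p : W → V) (s : Finset W)
    (hs : Module.finrank ℝ V + 2 ≤ s.card) :
    ∃ t ⊆ s, (convexHull ℝ (p '' t) ∩ convexHull ℝ (p '' {x ∈ s | x ∉ t})).Nonempty := by
  classical
  have hdep : ¬ AffineIndependent ℝ (fun i : s => p i) := by
    intro h
    have h1 := h.card_le_finrank_succ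
    have h2 := Submodule.finrank_le (vectorSpan ℝ (Set.range fun i : s => p i))
    rw [Fintype.card_coe] at h1
    omega
  obtain ⟨I, x, hx1, hx2⟩ := Convex.radon_partition hdep
  refine ⟨s.filter fun i => ∃ h : i ∈ s, (⟨i, h⟩ : s) ∈ I, Finset.filter_subset _ _, x,
    convexHull_mono ?_ hx1, convexHull_mono ?_ hx2⟩
  · rintro _ ⟨i, hi, rfl⟩
    exact ⟨i, by simpa using hi, rfl⟩
  · rintro _ ⟨i, hi, rfl⟩
    exact ⟨i, by simpa using hi, rfl⟩

end Convexity

/-! ### Geometry of cliques with exposed edges. -/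

section Cliques

variable {W V : Type*} [AddCommGroup V] [Module ℝ V] {G : SimpleGraph W} {p : W → V}

theorem EdgesExposed.exists_functional (h : EdgesExposed G p) {x y : W} (hxy : G.Adj x y) :
    ∃ f : V →ₗ[ℝ] ℝ, (∀ z, G.Adj x z → z ≠ y → f (p z) < f (p y)) ∧
      (∀ z, G.Adj y z → z ≠ x → f (p z) < f (p x)) := by
  obtain ⟨f, hf⟩ := h x y hxy
  refine ⟨f, fun z hz hzy => ?_, fun z hz hzx => ?_⟩
  · have := hf x z hz (Sym2.congr_right.not.2 hzy)
    linarith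
  · have := hf z y hz.symm (Sym2.congr_left.not.2 hzx)
    linarith

/-- The functional exposing xy is smaller at every other clique vertex z than at both x and y, by
comparing xy with xz and yz; hence it separates the two hulls. -/
theorem EdgesExposed.disjoint_convexHull_pair (h : EdgesExposed G p) {s : Finset W}
    (hs : G.IsClique (s : Set W)) {x y : W} (hx : x ∈ s) (hy : y ∈ s) (hxy : x ≠ y) :
    Disjoint (convexHull ℝ (p '' {x, y})) (convexHull ℝ (p '' {z ∈ s | z ≠ x ∧ z ≠ y})) := by
  obtain ⟨f, hfy, hfx⟩ := h.exists_functional (hs hx hy hxy)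
  rw [Set.disjoint_left]
  intro q hq hq'
  have h1 : min (f (p x)) (f (p y)) ≤ f q := by
    refine le_of_mem_convexHull f ?_ hq
    rintro _ ⟨z, rfl | rfl, rfl⟩ <;> simp
  have h2 : f q < min (f (p x)) (f (p y)) := by
    refine lt_of_mem_convexHull f ?_ hq'
    rintro _ ⟨z, ⟨hz, hzx, hzy⟩, rfl⟩
    exact lt_min (hfx z (hs hy hz hzy.symm) hzx) (hfy z (hs hx hz hzx.symm) hzy)
  exact absurd h1 h2.not_ge

theorem EdgesExposed.exists_mem_convexHull_of_small_part (h : EdgesExposed G p) {s t : Finset W}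
    (hs : G.IsClique (s : Set W)) (hts : t ⊆ s) (ht : t.card ≤ 2)
    (hne : (convexHull ℝ (p '' t) ∩ convexHull ℝ (p '' {x ∈ s | x ∉ t})).Nonempty) :
    ∃ v ∈ s, p v ∈ convexHull ℝ (p '' {x ∈ s | x ≠ v}) := by
  classical
  obtain ⟨q, hq1, hq2⟩ := hne
  obtain h0 | h1 | h2 : t.card = 0 ∨ t.card = 1 ∨ t.card = 2 := by omega
  · rw [Finset.card_eq_zero] at h0
    simp [h0] at hq1
  · obtain ⟨v, rfl⟩ := Finset.card_eq_one.1 h1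
    refine ⟨v, hts (by simp), ?_⟩
    rw [Finset.coe_singleton, Set.image_singleton, convexHull_singleton,
      Set.mem_singleton_iff] at hq1
    subst hq1
    simpa using hq2
  · obtain ⟨x, y, hxy, rfl⟩ := Finset.card_eq_two.1 h2
    refine absurd hq2 (Set.disjoint_left.1 (by
      simpa using h.disjoint_convexHull_pair hs (hts (by simp)) (hts (by simp)) hxy) hq1)

/-- One side of a Radon partition of five points has at most two points. It cannot be an edge, since
an edge's hull misses the hull of the other three, so it is a single vertex. -/
theorem EdgesExposed.exists_center [FiniteDimensional ℝ V] (hV : Module.finrank ℝ V = 3)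
    (h : EdgesExposed G p) {s : Finset W} (hs : G.IsNClique 5 s) :
    ∃ v ∈ s, p v ∈ convexHull ℝ (p '' {x ∈ s | x ≠ v}) := by
  classical
  obtain ⟨t, hts, hne⟩ := radon_partition_finset p s (by rw [hV, hs.card_eq])
  by_cases ht : t.card ≤ 2
  · exact h.exists_mem_convexHull_of_small_part hs.isClique hts ht hne
  · refine h.exists_mem_convexHull_of_small_part hs.isClique (t := s \ t) Finset.sdiff_subset ?_ ?_
    · rw [Finset.card_sdiff_of_subset hts, hs.card_eq]
      omega
    · have e1 : ((s \ t : Finset W) : Set W) = {x | x ∈ s ∧ x ∉ t} := by ext; simp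
      have e2 : {x | x ∈ s ∧ x ∉ s \ t} = (t : Set W) := by
        ext x
        have := @hts x
        simp only [Finset.mem_sdiff, Set.mem_ofPred_eq, Finset.mem_coe]
        tauto
      rw [e1, e2, Set.inter_comm]
      exact hne

/-- Two vertices joined to all of a clique cannot both be drawn in the convex hull of that
clique. -/
theorem EdgesExposed.eq_of_mem_convexHull (h : EdgesExposed G p) {Q : Finset W} {v w : W}
    (hQ : G.IsClique (Q : Set W)) (hv : ∀ u ∈ Q, G.Adj v u) (hw : ∀ u ∈ Q, G.Adj w u)
    (hpv : p v ∈ convexHull ℝ (p '' Q)) (hpw : p w ∈ convexHull ℝ (p '' Q)) : w = v := by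
  classical
  by_contra hne
  obtain ⟨a, ha, ha1, hav⟩ := mem_convexHull_image_finset p Q hpv
  obtain ⟨b, hb, hb1, hbw⟩ := mem_convexHull_image_finset p Q hpw
  -- The function g is f - f(p v) on Q, where f exposes the edge vj; a and b are barycentric
  -- coordinates of v and w.
  have key : ∀ j ∈ Q, ∃ g : W → ℝ, (∀ k ∈ Q, k ≠ j → g k < 0) ∧ ∑ k ∈ Q, a k * g k = 0 ∧
      ∑ k ∈ Q, b k * g k < 0 := by
    intro j hj
    obtain ⟨f, hfj, hfv⟩ := h.exists_functional (hv j hj)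
    refine ⟨fun k => f (p k) - f (p v), fun k hk hkj => ?_, ?_, ?_⟩
    · exact sub_neg.2 (hfv k (hQ hj hk hkj.symm) (hv k hk).ne')
    · have := congrArg f hav
      simp only [map_sum, map_smul, smul_eq_mul] at this
      simp only [mul_sub, Finset.sum_sub_distrib, ← Finset.sum_mul, this, ha1]
      ring
    · have := congrArg f hbw
      simp only [map_sum, map_smul, smul_eq_mul] at this
      simp only [mul_sub, Finset.sum_sub_distrib, ← Finset.sum_mul, this, hb1, one_mul]
      exact sub_neg.2 (hfv w (hw j hj).symm hne)
  by_cases hpos : ∀ j ∈ Q, 0 < a j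
  -- Maximality of b j / a j makes all coefficients b j * a k - a j * b k nonnegative and the one at
  -- j zero. The sum against g is then at most 0, yet equals -a j times a negative number.
  · have hQne : Q.Nonempty := by
      rw [Finset.nonempty_iff_ne_empty]
      rintro rfl
      simp at ha1
    obtain ⟨j, hj, hmax⟩ := Finset.exists_max_image Q (fun k => b k / a k) hQne
    obtain ⟨g, hg, hga, hgb⟩ := key j hj
    have hsum : ∑ k ∈ Q, (b j * a k - a j * b k) * g k ≤ 0 := by
      refine Finset.sum_nonpos fun k hk => ?_
      rcases eq_or_ne k j with rfl | hkj
      · simp [mul_comm]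
      · have := hmax k hk
        rw [div_le_div_iff₀ (hpos k hk) (hpos j hj)] at this
        exact mul_nonpos_of_nonneg_of_nonpos (by linarith) (hg k hk hkj).le
    have heq : ∑ k ∈ Q, (b j * a k - a j * b k) * g k =
        b j * ∑ k ∈ Q, a k * g k - a j * ∑ k ∈ Q, b k * g k := by
      rw [Finset.mul_sum, Finset.mul_sum, ← Finset.sum_sub_distrib]
      exact Finset.sum_congr rfl fun k _ => by ring
    have := mul_neg_of_pos_of_neg (hpos j hj) hgb
    rw [heq, hga] at hsum
    linarith
  -- If a j = 0, the vanishing sum of a k * g k has only nonpositive terms, so every a k is zero,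
  -- against their sum 1.
  · push Not at hpos
    obtain ⟨j, hj, haj⟩ := hpos
    have haj0 : a j = 0 := le_antisymm haj (ha j hj)
    obtain ⟨g, hg, hga, -⟩ := key j hj
    have hle : ∀ k ∈ Q, a k * g k ≤ 0 := by
      intro k hk
      rcases eq_or_ne k j with rfl | hkj
      · simp [haj0]
      · exact mul_nonpos_of_nonneg_of_nonpos (ha k hk) (hg k hk hkj).le
    have hzero := (Finset.sum_eq_zero_iff_of_nonpos hle).1 hga
    have : ∑ k ∈ Q, a k = 0 := by
      refine Finset.sum_eq_zero fun k hk => ?_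
      rcases eq_or_ne k j with rfl | hkj
      · exact haj0
      · exact (mul_eq_zero.1 (hzero k hk)).resolve_right (hg k hk hkj).ne
    linarith

/-- In dimension three every `5`-clique has a vertex that is the only common neighbour of the
other four. -/
theorem EdgesExposed.exists_unique_common_neighbor [FiniteDimensional ℝ V]
    (hV : Module.finrank ℝ V = 3) (h : EdgesExposed G p) {s : Finset W} (hs : G.IsNClique 5 s) :
    ∃ v ∈ s, ∀ w, (∀ u ∈ s, u ≠ v → G.Adj w u) → w = v := by
  classical
  obtain ⟨v, hvs, hv⟩ := h.exists_center hV hs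
  refine ⟨v, hvs, fun w hw => ?_⟩
  have hcoe : {x | x ∈ s ∧ x ≠ v} = ((s.erase v : Finset W) : Set W) := by
    ext; simp [and_comm]
  set Q := s.erase v with hQ
  have hQs : Q ⊆ s := Finset.erase_subset _ _
  rw [hcoe] at hv
  have hQc : G.IsClique (Q : Set W) := hs.isClique.subset (by exact_mod_cast hQs)
  have hvQ : ∀ u ∈ Q, G.Adj v u := fun u hu =>
    hs.isClique hvs (hQs hu) (Finset.ne_of_mem_erase hu).symm
  have hwQ : ∀ u ∈ Q, G.Adj w u := fun u hu => hw u (hQs hu) (Finset.ne_of_mem_erase hu)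
  have hwnQ : w ∉ Q := fun hmem => (hwQ w hmem).ne rfl
  have hQ4 : G.IsNClique 4 Q := ⟨hQc, by rw [hQ, Finset.card_erase_of_mem hvs, hs.card_eq]⟩
  -- Replacing v by w gives another 5-clique, with some centre u. If u = w, both v and w lie in the
  -- hull of Q. If u is in Q and w ≠ v, the functional exposing vu is below its value at v on w and
  -- Q minus u, hence at u, hence on all of Q, contradicting that v is in the hull of Q.
  obtain ⟨u, hu, hpu⟩ := h.exists_center hV (hQ4.insert hwQ)
  rcases Finset.mem_insert.1 hu with rfl | huQ
  · refine h.eq_of_mem_convexHull hQc hvQ hwQ hv (convexHull_mono (Set.image_mono ?_) hpu)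
    rintro x ⟨hx, hxu⟩
    exact (Finset.mem_insert.1 hx).resolve_left hxu
  · by_contra hne
    obtain ⟨f, hfu, hfv⟩ := h.exists_functional (hvQ u huQ)
    have hQv : ∀ x ∈ Q, x ≠ u → f (p x) < f (p v) := fun x hx hxu =>
      hfv x (hQc huQ hx hxu.symm) (hvQ x hx).ne'
    have huv : f (p u) < f (p v) := by
      refine lt_of_mem_convexHull f ?_ hpu
      rintro _ ⟨x, ⟨hx, hxu⟩, rfl⟩
      rcases Finset.mem_insert.1 hx with rfl | hx
      · exact hfv x (hwQ u huQ).symm hne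
      · exact hQv x hx hxu
    refine lt_irrefl (f (p v)) (lt_of_mem_convexHull f ?_ hv)
    rintro _ ⟨x, hx, rfl⟩
    rcases eq_or_ne x u with rfl | hxu
    · exact huv
    · exact hQv x hx hxu

end Cliques

/-! ### Edge counting by deleting four vertices of a 5-clique. -/

section Counting

open Finset

variable {W : Type*}

open Classical in
/-- The number of ordered pairs of adjacent vertices in `U`. -/
noncomputable def dartCount (G : SimpleGraph W) (U : Finset W) : ℕ :=
  ∑ x ∈ U, #{y ∈ U | G.Adj x y}

open Classical in
theorem dartCount_eq_add (G : SimpleGraph W) {Q U : Finset W} (hQU : Q ⊆ U) :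
    dartCount G U = dartCount G (U \ Q) + 2 * ∑ x ∈ U \ Q, #{y ∈ Q | G.Adj x y} +
      dartCount G Q := by
  have hsplit : ∀ x, #{y ∈ U | G.Adj x y} = #{y ∈ U \ Q | G.Adj x y} + #{y ∈ Q | G.Adj x y} := by
    intro x
    simp only [card_filter]
    exact (sum_sdiff hQU).symm
  have hcomm : ∑ x ∈ Q, #{y ∈ U \ Q | G.Adj x y} = ∑ x ∈ U \ Q, #{y ∈ Q | G.Adj x y} := by
    simp only [card_filter]
    rw [sum_comm]
    simp only [G.adj_comm]
  unfold dartCount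
  rw [← sum_sdiff hQU]
  simp only [hsplit, sum_add_distrib, hcomm]
  ring

theorem dartCount_univ [Fintype W] (G : SimpleGraph W) [Fintype G.edgeSet] :
    dartCount G univ = 2 * #G.edgeFinset := by
  classical
  have h := G.sum_degrees_eq_twice_card_edges
  simp only [SimpleGraph.degree, SimpleGraph.neighborFinset_eq_filter] at h
  unfold dartCount
  convert h

theorem dartCount_le_of_cliqueFree (G : SimpleGraph W) (U : Finset W)
    (hU : ∀ s ⊆ U, ¬ G.IsNClique 5 s) : 4 * dartCount G U ≤ 3 * #U ^ 2 := by
  classical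
  let H := G.induce (U : Set W)
  have hfree : H.CliqueFree (4 + 1) := by
    intro s hs
    refine hU (s.map (Function.Embedding.subtype _)) ?_ ?_
    · intro x hx
      obtain ⟨y, -, rfl⟩ := Finset.mem_map.1 hx
      exact y.2
    · exact (hs.map (f := Function.Embedding.subtype _)).mono (SimpleGraph.map_comap_le _ _)
  have h1 := hfree.card_edgeFinset_le
  dsimp only at h1
  rw [← SimpleGraph.card_edgeFinset_turanGraph] at h1
  have h2 := SimpleGraph.mul_card_edgeFinset_turanGraph_le (n := Fintype.card (U : Set W)) (r := 4)
  have h3 := dartCount_univ H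
  have h4 : dartCount H univ = dartCount G U := by
    unfold dartCount
    simp only [card_filter]
    exact sum_coe_sort U (fun x => ∑ y : (U : Set W), if G.Adj x y then 1 else 0) |>.trans
      (sum_congr rfl fun x _ => sum_coe_sort U (fun y => if G.Adj x y then 1 else 0))
  have h5 : Fintype.card (U : Set W) = #U := Fintype.card_coe U
  rw [h5] at h1 h2
  omega

/-- The linear term is what makes the induction close: with m vertices left, 3m² + 2m + 8(3m + 1) +
48 is exactly 3(m + 4)² + 2(m + 4). -/
theorem dartCount_le (G : SimpleGraph W)
    (hG : ∀ s, G.IsNClique 5 s → ∃ v ∈ s, ∀ w, (∀ u ∈ s, u ≠ v → G.Adj w u) → w = v)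
    (U : Finset W) : 4 * dartCount G U ≤ 3 * #U ^ 2 + 2 * #U := by
  classical
  induction U using Finset.strongInduction with
  | H U ih =>
    by_cases hU : ∀ s ⊆ U, ¬ G.IsNClique 5 s
    · exact (dartCount_le_of_cliqueFree G U hU).trans (Nat.le_add_right _ _)
    push Not at hU
    obtain ⟨s, hsU, hs⟩ := hU
    obtain ⟨v, hvs, hv⟩ := hG s hs
    set Q := s.erase v with hQ
    have hQU : Q ⊆ U := (erase_subset _ _).trans hsU
    have hQ4 : #Q = 4 := by rw [hQ, card_erase_of_mem hvs, hs.card_eq]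
    have hlt : U \ Q ⊂ U := sdiff_ssubset hQU (card_pos.1 (by omega))
    have hrec := ih _ hlt
    have hinner : dartCount G Q ≤ 12 := by
      have : ∀ x ∈ Q, #{y ∈ Q | G.Adj x y} ≤ 3 := by
        intro x hx
        have hsub : {y ∈ Q | G.Adj x y} ⊆ Q.erase x := by
          intro y hy
          rw [mem_filter] at hy
          exact mem_erase.2 ⟨hy.2.ne', hy.1⟩
        calc _ ≤ #(Q.erase x) := card_le_card hsub
          _ = 3 := by rw [card_erase_of_mem hx, hQ4]
      calc _ ≤ #Q • 3 := sum_le_card_nsmul _ _ _ this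
        _ = 12 := by rw [hQ4]; rfl
    -- Only v is adjacent to all four vertices of Q, which accounts for the extra 1.
    have hcross : ∑ x ∈ U \ Q, #{y ∈ Q | G.Adj x y} ≤ 3 * #(U \ Q) + 1 := by
      have hle : ∀ x ∈ U \ Q, #{y ∈ Q | G.Adj x y} ≤ 3 + if x = v then 1 else 0 := by
        intro x _
        split_ifs with hxv
        · exact (card_filter_le _ _).trans hQ4.le
        · by_contra hcon
          have h4 : #{y ∈ Q | G.Adj x y} = #Q :=
            le_antisymm (card_filter_le _ _) (by omega)
          rw [card_filter_eq_iff] at h4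
          exact hxv (hv x fun u hu huv => h4 u (mem_erase.2 ⟨huv, hu⟩))
      calc _ ≤ ∑ x ∈ U \ Q, (3 + if x = v then 1 else 0) := sum_le_sum hle
        _ ≤ 3 * #(U \ Q) + 1 := by
          rw [sum_add_distrib, sum_const, smul_eq_mul, mul_comm, sum_ite_eq']
          gcongr
          split_ifs <;> omega
    have hcard : #U = #(U \ Q) + 4 := by rw [← hQ4, card_sdiff_add_card_eq_card hQU]
    rw [dartCount_eq_add G hQU, hcard]
    nlinarith

end Counting

/-! ### Translation between convexly independent midpoints and exposed edges. -/

section Midpoints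

variable {d : ℕ}

theorem map_pairMidpoint (f : EuclideanSpace ℝ (Fin d) →ₗ[ℝ] ℝ) (x y : EuclideanSpace ℝ (Fin d)) :
    f (pairMidpoint s(x, y)) = (f x + f y) / 2 := by
  simp only [pairMidpoint, Sym2.lift_mk, midpoint_eq_smul_add, map_smul, map_add, smul_eq_mul,
    invOf_eq_inv]
  ring

/-- The hull of the finitely many other midpoints is closed and convex, so Hahn–Banach separates the
remaining midpoint strictly from it. -/
theorem MidpointsConvexIndependent.exists_functional
    {S : Finset (Sym2 (EuclideanSpace ℝ (Fin d)))} (hS : MidpointsConvexIndependent S)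
    {e : Sym2 (EuclideanSpace ℝ (Fin d))} (he : e ∈ S) :
    ∃ f : EuclideanSpace ℝ (Fin d) →ₗ[ℝ] ℝ, ∀ e' ∈ S, e' ≠ e →
      f (pairMidpoint e') < f (pairMidpoint e) := by
  classical
  have hnot := convexIndependent_iff_notMem_convexHull_sdiff.1 hS ⟨e, he⟩ Set.univ
  have hfin : ((fun e : S => pairMidpoint (e : Sym2 (EuclideanSpace ℝ (Fin d)))) ''
      (Set.univ \ {⟨e, he⟩})).Finite := Set.toFinite _
  obtain ⟨f, u, hf, hu⟩ := geometric_hahn_banach_closed_point (convex_convexHull ℝ _)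
    (hfin.isClosed_convexHull ℝ) hnot
  refine ⟨f.toLinearMap, fun e' he' hne => ?_⟩
  refine (hf _ (subset_convexHull ℝ _ ⟨⟨e', he'⟩, ⟨trivial, ?_⟩, rfl⟩)).trans hu
  simpa using hne

theorem midpointsConvexIndependent_of_exists_functional
    {S : Finset (Sym2 (EuclideanSpace ℝ (Fin d)))}
    (h : ∀ e ∈ S, ∃ f : EuclideanSpace ℝ (Fin d) →ₗ[ℝ] ℝ, ∀ e' ∈ S, e' ≠ e →
      f (pairMidpoint e') < f (pairMidpoint e)) : MidpointsConvexIndependent S := by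
  intro s e he
  by_contra hes
  obtain ⟨f, hf⟩ := h e e.2
  refine lt_irrefl _ (lt_of_mem_convexHull f ?_ he)
  rintro _ ⟨e', he', rfl⟩
  exact hf e' e'.2 fun heq => hes (Subtype.ext heq ▸ he')

theorem eight_mul_card_le {P : Finset (EuclideanSpace ℝ (Fin 3))}
    {S : Finset (Sym2 (EuclideanSpace ℝ (Fin 3)))} (hSP : S ⊆ pairs P)
    (hS : MidpointsConvexIndependent S) : 8 * S.card ≤ 3 * P.card ^ 2 + 2 * P.card := by
  classical
  let G : SimpleGraph P :=
    (SimpleGraph.fromEdgeSet (S : Set (Sym2 (EuclideanSpace ℝ (Fin 3))))).comap Subtype.val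
  have hadj : ∀ x y : P, G.Adj x y ↔ s(x.1, y.1) ∈ S ∧ x.1 ≠ y.1 := by
    intro x y
    simp [G]
  have hexp : EdgesExposed G (Subtype.val : P → EuclideanSpace ℝ (Fin 3)) := by
    intro x y hxy
    obtain ⟨f, hf⟩ := hS.exists_functional ((hadj x y).1 hxy).1
    refine ⟨f, fun z w hzw hne => ?_⟩
    have := hf _ ((hadj z w).1 hzw).1 fun heq => hne ?_
    · rw [map_pairMidpoint, map_pairMidpoint] at this
      linarith
    · exact Sym2.map.injective Subtype.val_injective heq
  have hcount := dartCount_le G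
    (fun s hs => hexp.exists_unique_common_neighbor (by simp) hs) Finset.univ
  rw [dartCount_univ, Finset.card_univ, Fintype.card_coe] at hcount
  have hle : S.card ≤ G.edgeFinset.card := by
    refine (Finset.card_le_card (t := G.edgeFinset.image (Sym2.map Subtype.val)) ?_).trans
      Finset.card_image_le
    intro e he
    have heP := hSP he
    induction e using Sym2.ind with
    | _ x y =>
      simp only [pairs, Finset.mem_filter, Finset.mk_mem_sym2_iff, Sym2.mk_isDiag_iff] at heP
      refine Finset.mem_image.2 ⟨s(⟨x, heP.1.1⟩, ⟨y, heP.1.2⟩), ?_, rfl⟩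
      rw [SimpleGraph.mem_edgeFinset, SimpleGraph.mem_edgeSet, hadj]
      exact ⟨he, heP.2⟩
  omega

theorem eight_mul_E_le (n : ℕ) : 8 * E 3 n ≤ 3 * n ^ 2 + 2 * n := by
  classical
  obtain ⟨P, rfl, hP⟩ := (isGreatest_E 3 n (by norm_num)).1
  rw [← hP]
  have : maxPairs P ≤ (3 * P.card ^ 2 + 2 * P.card) / 8 := by
    refine Finset.sup_le fun S hS => ?_
    rw [Finset.mem_filter, Finset.mem_powerset] at hS
    have := eight_mul_card_le hS.1 hS.2
    omega
  omega

theorem card_edgeFinset_le_E {n : ℕ} (hd : 0 < d) (G : SimpleGraph (Fin n)) [DecidableRel G.Adj]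
    {p : Fin n → EuclideanSpace ℝ (Fin d)} (hp : Function.Injective p) (h : EdgesExposed G p) :
    G.edgeFinset.card ≤ E d n := by
  classical
  have hP : maxPairs (Finset.univ.image p) ≤ E d n :=
    (isGreatest_E d n hd).2 ⟨_, by rw [Finset.card_image_of_injective _ hp]; simp, rfl⟩
  refine le_trans ?_ hP
  rw [← Finset.card_image_of_injective G.edgeFinset (Sym2.map.injective hp)]
  refine Finset.le_sup (f := Finset.card) (Finset.mem_filter.2 ⟨Finset.mem_powerset.2 ?_, ?_⟩)
  · intro e' he'
    obtain ⟨e, he, rfl⟩ := Finset.mem_image.1 he'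
    clear he'
    induction e using Sym2.ind with
    | _ x y =>
      rw [SimpleGraph.mem_edgeFinset, SimpleGraph.mem_edgeSet] at he
      simp [pairs, hp.eq_iff, he.ne]
  · refine midpointsConvexIndependent_of_exists_functional fun e' he' => ?_
    obtain ⟨e, he, rfl⟩ := Finset.mem_image.1 he'
    clear he'
    induction e using Sym2.ind with
    | _ x y =>
      rw [SimpleGraph.mem_edgeFinset, SimpleGraph.mem_edgeSet] at he
      obtain ⟨f, hf⟩ := h x y he
      refine ⟨f, fun e'' he'' hne => ?_⟩
      obtain ⟨e', he', rfl⟩ := Finset.mem_image.1 he''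
      clear he''
      induction e' using Sym2.ind with
      | _ z w =>
        rw [SimpleGraph.mem_edgeFinset, SimpleGraph.mem_edgeSet] at he'
        have := hf z w he' fun heq => hne (by rw [heq])
        rw [Sym2.map_mk, Sym2.map_mk, map_pairMidpoint, map_pairMidpoint]
        linarith

end Midpoints

/-! ### Lower bound from three parabola arcs. -/

section Construction

/-- A point with parameter `t` on the parabola arc through the `c`-th standard basis vector. -/
noncomputable def arcPoint (c : Fin 3) (t : ℝ) : EuclideanSpace ℝ (Fin 3) :=
  WithLp.toLp 2 fun i => if i = c then 1 + t - t ^ 2 else -t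

theorem arcPoint_self (c : Fin 3) (t : ℝ) : arcPoint c t c = 1 + t - t ^ 2 := by
  simp [arcPoint]

theorem arcPoint_of_ne {c i : Fin 3} (h : i ≠ c) (t : ℝ) : arcPoint c t i = -t := by
  simp [arcPoint, h]

theorem arcPoint_inj {c d : Fin 3} {s t : ℝ} (hs0 : 0 ≤ s) (hs1 : s < 1) (ht0 : 0 ≤ t)
    (h : arcPoint c s = arcPoint d t) : c = d ∧ s = t := by
  have hcd : c = d := by
    by_contra hne
    have := congrArg (fun x : EuclideanSpace ℝ (Fin 3) => x c) h
    simp only [arcPoint_self, arcPoint_of_ne hne] at this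
    nlinarith
  subst hcd
  obtain ⟨i, hi⟩ := exists_ne c
  have := congrArg (fun x : EuclideanSpace ℝ (Fin 3) => x i) h
  simp only [arcPoint_of_ne hi] at this
  exact ⟨rfl, by linarith⟩

/-- The functional exposing the sum of the points with parameters `s` and `r` on two arcs. -/
theorem exists_exposing_functional {c d : Fin 3} (hcd : c ≠ d) {s r : ℝ} (hs0 : 0 ≤ s)
    (hs1 : s < 1) (hr0 : 0 ≤ r) (hr1 : r < 1) :
    ∃ f : EuclideanSpace ℝ (Fin 3) →ₗ[ℝ] ℝ,
      0 < f (arcPoint c s) ∧ 0 < f (arcPoint d r) ∧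
      (∀ t, t ≠ s → f (arcPoint c t) < f (arcPoint c s)) ∧
      (∀ t, t ≠ r → f (arcPoint d t) < f (arcPoint d r)) ∧
      ∀ e t, e ≠ c → e ≠ d → 0 ≤ t → t < 1 → f (arcPoint e t) ≤ 0 := by
  obtain ⟨e, hec, hed⟩ : ∃ e : Fin 3, e ≠ c ∧ e ≠ d := by
    revert c d
    decide
  -- This weight of the third coordinate places the maxima of f on arcs c and d exactly at s and r;
  -- being nonnegative, it also keeps f nonpositive on the third arc.
  let γ := s * (1 - r) + r * (1 - s)
  have hγ : 0 ≤ γ := by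
    have h1 := mul_nonneg hs0 (sub_nonneg.2 hr1.le)
    have h2 := mul_nonneg hr0 (sub_nonneg.2 hs1.le)
    exact add_nonneg h1 h2
  let f : EuclideanSpace ℝ (Fin 3) →ₗ[ℝ] ℝ :=
    (1 - r) • EuclideanSpace.projₗ c + (1 - s) • EuclideanSpace.projₗ d -
      γ • EuclideanSpace.projₗ e
  have hf : ∀ x, f x = (1 - r) * x c + (1 - s) * x d - γ * x e := fun x => by simp [f]
  have hfc : ∀ t, f (arcPoint c t) = (1 - r) * (1 + s ^ 2 - (t - s) ^ 2) := fun t => by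
    rw [hf, arcPoint_self, arcPoint_of_ne hcd.symm, arcPoint_of_ne hec]
    ring
  have hfd : ∀ t, f (arcPoint d t) = (1 - s) * (1 + r ^ 2 - (t - r) ^ 2) := fun t => by
    rw [hf, arcPoint_self, arcPoint_of_ne hcd, arcPoint_of_ne hed]
    ring
  have hr : 0 < 1 - r := sub_pos.2 hr1
  have hs : 0 < 1 - s := sub_pos.2 hs1
  refine ⟨f, ?_, ?_, fun t ht => ?_, fun t ht => ?_, fun e' t hc hd ht0 ht1 => ?_⟩
  · rw [hfc, sub_self]
    exact mul_pos (by assumption) (by linarith [sq_nonneg s, sq_nonneg r])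
  · rw [hfd, sub_self]
    exact mul_pos (by assumption) (by linarith [sq_nonneg s, sq_nonneg r])
  · have : 0 < (t - s) ^ 2 := by have := sub_ne_zero.2 ht; positivity
    rw [hfc, hfc]
    exact mul_lt_mul_of_pos_left (by rw [sub_self]; linarith) hr
  · have : 0 < (t - r) ^ 2 := by have := sub_ne_zero.2 ht; positivity
    rw [hfd, hfd]
    exact mul_lt_mul_of_pos_left (by rw [sub_self]; linarith) hs
  · obtain rfl : e' = e := by omega
    rw [hf, arcPoint_self, arcPoint_of_ne hec.symm, arcPoint_of_ne hed.symm]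
    have h1 := mul_nonneg hr.le ht0
    have h2 := mul_nonneg hs.le ht0
    have h3 : 0 ≤ γ * (1 + t - t ^ 2) := mul_nonneg hγ (by nlinarith)
    linarith

/-- A proper colouring prevents an edge from having both ends on one arc. Its sum is thus at most
the two positive arc maxima together, with equality only for xy, since an end on the third arc
contributes at most 0. -/
theorem edgesExposed_of_arcPoint {W : Type*} (G : SimpleGraph W) (c : W → Fin 3) (t : W → ℝ)
    (ht0 : ∀ i, 0 ≤ t i) (ht1 : ∀ i, t i < 1) (ht : Function.Injective t)
    (hc : ∀ i j, G.Adj i j → c i ≠ c j) : EdgesExposed G fun i => arcPoint (c i) (t i) := by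
  intro x y hxy
  obtain ⟨f, hx, hy, hfx, hfy, hf⟩ :=
    exists_exposing_functional (hc x y hxy) (ht0 x) (ht1 x) (ht0 y) (ht1 y)
  refine ⟨f, fun z w hzw hne => ?_⟩
  have hcxy := hc x y hxy
  have hczw := hc z w hzw
  have bx : ∀ i, c i = c x → i = x ∨ f (arcPoint (c i) (t i)) < f (arcPoint (c x) (t x)) := by
    intro i hi
    refine or_iff_not_imp_left.2 fun hix => ?_
    rw [hi]
    exact hfx _ (ht.ne hix)
  have bY : ∀ i, c i = c y → i = y ∨ f (arcPoint (c i) (t i)) < f (arcPoint (c y) (t y)) := by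
    intro i hi
    refine or_iff_not_imp_left.2 fun hiy => ?_
    rw [hi]
    exact hfy _ (ht.ne hiy)
  have b0 : ∀ i, c i ≠ c x → c i ≠ c y → f (arcPoint (c i) (t i)) ≤ 0 := fun i h1 h2 =>
    hf _ _ h1 h2 (ht0 i) (ht1 i)
  have hcases : ∀ i, c i = c x ∨ c i = c y ∨ (c i ≠ c x ∧ c i ≠ c y) := fun i => by tauto
  have hxx : ∀ i, c i = c x → f (arcPoint (c i) (t i)) ≤ f (arcPoint (c x) (t x)) := fun i hi => by
    rcases bx i hi with rfl | h
    exacts [le_rfl, h.le]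
  have hyy : ∀ i, c i = c y → f (arcPoint (c i) (t i)) ≤ f (arcPoint (c y) (t y)) := fun i hi => by
    rcases bY i hi with rfl | h
    exacts [le_rfl, h.le]
  dsimp only
  rcases hcases z with hz | hz | hz <;> rcases hcases w with hw | hw | hw
  · exact absurd (hz.trans hw.symm) hczw
  · rcases bx z hz with rfl | h1
    · rcases bY w hw with rfl | h2
      · exact absurd rfl hne
      · linarith
    · linarith [hyy w hw]
  · linarith [hxx z hz, b0 w hw.1 hw.2]
  · rcases bY z hz with rfl | h1
    · rcases bx w hw with rfl | h2
      · exact absurd Sym2.eq_swap hne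
      · linarith
    · linarith [hxx w hw]
  · exact absurd (hz.trans hw.symm) hczw
  · linarith [hyy z hz, b0 w hw.1 hw.2]
  · linarith [hxx w hw, b0 z hz.1 hz.2]
  · linarith [hyy w hw, b0 z hz.1 hz.2]
  · linarith [b0 z hz.1 hz.2, b0 w hw.1 hw.2]

theorem sq_div_three_le_card_edgeFinset_turanGraph (n : ℕ) :
    n ^ 2 / 3 ≤ (SimpleGraph.turanGraph n 3).edgeFinset.card := by
  rw [SimpleGraph.card_edgeFinset_turanGraph]
  have hlt : n % 3 < 3 := Nat.mod_lt _ (by norm_num)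
  have hle : (n % 3) ^ 2 ≤ n ^ 2 := Nat.pow_le_pow_left (Nat.mod_le _ _) 2
  have hmod : n ^ 2 % 3 = (n % 3) ^ 2 % 3 := Nat.pow_mod _ _ _
  -- For each residue, `hle` controls the truncated subtraction in the Turán number and `hmod` the
  -- rounding in the divisions.
  generalize n % 3 = r at hlt hle hmod ⊢
  interval_cases r <;> simp [Nat.choose] at hle hmod ⊢ <;> omega

theorem sq_div_three_le_E (n : ℕ) : n ^ 2 / 3 ≤ E 3 n := by
  refine (sq_div_three_le_card_edgeFinset_turanGraph n).trans ?_
  let c : Fin n → Fin 3 := fun i => ⟨i % 3, Nat.mod_lt _ (by norm_num)⟩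
  let t : Fin n → ℝ := fun i => (i : ℝ) / n
  have hn : ∀ i : Fin n, (0 : ℝ) < n := fun i => by exact_mod_cast i.pos
  have ht0 : ∀ i, 0 ≤ t i := fun i => by positivity
  have ht1 : ∀ i, t i < 1 := fun i => by
    rw [div_lt_one (hn i)]
    exact_mod_cast i.2
  have ht : Function.Injective t := fun i j hij => by
    have := (div_left_inj' (hn i).ne').1 hij
    exact Fin.ext (by exact_mod_cast this)
  refine card_edgeFinset_le_E (by norm_num) _ (p := fun i => arcPoint (c i) (t i)) ?_ ?_
  · exact fun i j hij => ht (arcPoint_inj (ht0 i) (ht1 i) (ht0 j) hij).2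
  · refine edgesExposed_of_arcPoint _ c t ht0 ht1 ht fun i j hij hc => ?_
    exact SimpleGraph.turanGraph_adj.1 hij (Fin.mk.inj_iff.1 hc)

end Construction

end MidpointGraphs

theorem theorem2 :
    (∀ n : ℕ, ⌊(1 / 3 : ℝ) * (n : ℝ) ^ 2⌋₊ ≤ MidpointGraphs.E 3 n) ∧
    (∃ C : ℝ, ∀ n : ℕ,
      (MidpointGraphs.E 3 n : ℝ) ≤ (3 / 8 : ℝ) * (n : ℝ) ^ 2 + C * (n : ℝ) ^ (3 / 2 : ℝ)) := by
  -- C = 1/4 comes from 8 E ≤ 3n² + 2n, and n ≤ n^(3/2) holds for every natural n, including 0.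
  refine ⟨fun n => ?_, 1 / 4, fun n => ?_⟩
  · have : (1 / 3 : ℝ) * (n : ℝ) ^ 2 = ((n ^ 2 : ℕ) : ℝ) / ((3 : ℕ) : ℝ) := by
      push_cast
      ring
    rw [this, Nat.floor_div_eq_div]
    exact MidpointGraphs.sq_div_three_le_E n
  · have h : (8 : ℝ) * MidpointGraphs.E 3 n ≤ 3 * (n : ℝ) ^ 2 + 2 * n := by
      exact_mod_cast MidpointGraphs.eight_mul_E_le n
    have hn : (n : ℝ) ≤ (n : ℝ) ^ (3 / 2 : ℝ) := by
      rcases Nat.eq_zero_or_pos n with rfl | hpos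
      · simp
      · exact Real.self_le_rpow_of_one_le (by exact_mod_cast hpos) (by norm_num)
    linarith
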